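/- Let $\mathcal X$ be an exact Mal'tsev category, that is, a Barr exact category in which every internal reflexive relation is an equivalence relation. Let $R_0$, $R_1$, $R_2$ be (internal) equivalence relations on an object $X$ of $\mathcal X$; meets $\wedge$ and joins $\vee$ are taken in the lattice of equivalence relations on the object in question. For equivalence relations $R$, $S$ on $X$, let $R\square S$ be the equivalence relation on the object $R$ which relates $(x,t)$ and $(y,z)$ if and only if $xSy$ and $tSz$. Let $\square_{i\in 3}R_i$ be the parallelistic $3$-fold equivalence relation on $R_0,R_1,R_2$, that is, the threefold reflexive graph of all $2\times 2\times 2$-matrices in $X$ any two entries of which that differ only in direction $i$ are related by $R_i$. The induced $3$-fold regular epimorphism $F=\mathrm{Coeq}_{i\in 3}(R_i)$ is the cube obtained from $\square_{i\in 3}R_i$ by taking coequalisers of reflexive graphs successively in the three directions (equivalently, by taking successive pushouts of the coequalisers $X\to X/R_i$). A $1$-cubic extension is a regular epimorphism. For $n\geq 2$, an $n$-cubic extension is an $n$-cube in $\mathcal X$, considered as a commutative square in the category of $(n-2)$-fold arrows, such that its four edges and the induced comparison morphism to the pullback of the edges with common codomain are $(n-1)$-cubic extensions. A family $(R_i)_{i\in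 n}$ of equivalence relations on $X$ is distributive if for all $k\geq 1$ and all pairwise disjoint $J_0,J_1,\dots,J_k\subseteq n$, $$\Big(\bigwedge_{j\in J_0}R_j\Big)\wedge\bigvee_{i=1}^k\Big(\bigwedge_{j\in J_i}R_j\Big)=\bigvee_{i=1}^k\Big(\bigwedge_{j\in J_0\cup J_i}R_j\Big),$$ where an empty meet is $X\times X$. A threefold reflexive graph is a distributive parallelistic $3$-fold equivalence relation if it is isomorphic to $\square_{i\in 3}S_i$ for some distributive family $(S_i)_{i\in 3}$ of equivalence relations on some object. Then the following conditions are equivalent: (i) $F$ is a $3$-cubic extension; (ii) $R_2\vee(R_0\wedge R_1)=(R_2\vee R_0)\wedge(R_2\vee R_1)$; (ii') $R_1\vee(R_0\wedge R_2)=(R_1\vee R_0)\wedge(R_1\vee R_2)$; (ii'') $R_0\vee(R_1\wedge R_2)=(R_0\vee R_1)\wedge(R_0\vee R_2)$; (iii) $R_2\wedge(R_0\vee R_1)=(R_2\wedge R_0)\vee(R_2\wedge R_1)$; (iii') $R_1\wedge(R_0\vee R_2)=(R_1\wedge R_0)\vee(R_1\wedge R_2)$; (iii'') $R_0\wedge(R_1\vee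 R_2)=(R_0\wedge R_1)\vee(R_0\wedge R_2)$; (iv) the family $(R_i)_{i\in 3}$ is distributive; (v) $\square_{i\in 3}R_i$ is a distributive parallelistic $3$-fold equivalence relation; (vi) $R_2\square(R_0\vee R_1)=(R_2\square R_0)\vee(R_2\square R_1)$, as equivalence relations on $R_2$; (vi') $R_1\square(R_0\vee R_2)=(R_1\square R_0)\vee(R_1\square R_2)$, as equivalence relations on $R_1$; (vi'') $R_0\square(R_1\vee R_2)=(R_0\square R_1)\vee(R_0\square R_2)$, as equivalence relations on $R_0$. -/

import Mathlib

open CategoryTheory CategoryTheory.Limits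

universe v u

namespace ExactMaltsev

/-! ### Exact Mal'tsev categories -/

/-- A (Barr) exact category: a regular category in which every internal equivalence relation is
effective, that is, the kernel pair of its coequaliser. -/
class BarrExact (C : Type u) [Category.{v} C] : Prop extends Regular C where
  effective {R X : C} (p₁ p₂ : R ⟶ X) :
    IsEquivalenceRelation p₁ p₂ → IsEffectiveEquivalenceRelation p₁ p₂

/-- A Mal'tsev category: a finitely complete category in which every internal reflexive relation
is an equivalence relation. -/
class Maltsev (C : Type u) [Category.{v} C] : Prop extends HasFiniteLimits C where
  isEquivalenceRelation {R X : C} (p₁ p₂ : R ⟶ X) :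
    ReflexiveRelation p₁ p₂ → IsEquivalenceRelation p₁ p₂

theorem mk_factors_iff' {C : Type u} [Category.{v} C] {Y Z T : C} (m : Z ⟶ Y) [Mono m]
    (f : T ⟶ Y) : (Subobject.mk m).Factors f ↔ ∃ g : T ⟶ Z, g ≫ m = f :=
  Subobject.mk_factors_iff m f

section Relations

variable {C : Type u} [Category.{v} C] [HasFiniteLimits C]

/-- The (generalised) elements `x, y : T ⟶ X` are related by the subobject `S` of `X ⨯ X`. -/
def RelOf {X : C} (S : Subobject (X ⨯ X)) {T : C} (x y : T ⟶ X) : Prop :=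
  S.Factors (prod.lift x y)

/-- An internal equivalence relation on `X`, as a subobject of `X ⨯ X`. -/
@[ext]
structure EqRel (X : C) where
  sub : Subobject (X ⨯ X)
  isEquivalenceRelation :
    IsEquivalenceRelation (sub.arrow ≫ prod.fst) (sub.arrow ≫ prod.snd)

theorem relOf_comp {X : C} {S : Subobject (X ⨯ X)} {T T' : C} (h : T' ⟶ T) {x y : T ⟶ X}
    (hxy : RelOf S x y) : RelOf S (h ≫ x) (h ≫ y) := by
  unfold RelOf at *
  rw [← prod.comp_lift]
  exact Subobject.factors_of_factors_right h hxy

theorem relOf_arrow {X : C} (S : Subobject (X ⨯ X)) :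
    RelOf S (S.arrow ≫ prod.fst) (S.arrow ≫ prod.snd) := by
  unfold RelOf
  rw [← prod.comp_lift, prod.lift_fst_snd, Category.comp_id]
  exact Subobject.factors_self S

theorem relOf_iff {X : C} (S : Subobject (X ⨯ X)) {T : C} (x y : T ⟶ X) :
    RelOf S x y ↔ ∃ h : T ⟶ (S : C), h ≫ S.arrow ≫ prod.fst = x ∧ h ≫ S.arrow ≫ prod.snd = y := by
  constructor
  · intro hxy
    unfold RelOf at hxy
    refine ⟨S.factorThru _ hxy, ?_, ?_⟩
    · rw [Subobject.factorThru_arrow_assoc, prod.lift_fst]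
    · rw [Subobject.factorThru_arrow_assoc, prod.lift_snd]
  · rintro ⟨h, rfl, rfl⟩
    exact relOf_comp h (relOf_arrow S)

theorem sub_le_iff {X : C} (S S' : Subobject (X ⨯ X)) :
    S ≤ S' ↔ ∀ (T : C) (x y : T ⟶ X), RelOf S x y → RelOf S' x y := by
  constructor
  · intro h T x y hxy
    exact Subobject.factors_of_le _ h hxy
  · intro h
    have h1 : S'.Factors _ := h _ _ _ (relOf_arrow S)
    have e : prod.lift (S.arrow ≫ prod.fst) (S.arrow ≫ prod.snd) = S.arrow := by
      rw [← prod.comp_lift, prod.lift_fst_snd, Category.comp_id]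
    rw [e] at h1
    exact Subobject.le_of_comm (S'.factorThru _ h1) (S'.factorThru_arrow _ h1)

theorem jointlyMono {X : C} (S : Subobject (X ⨯ X)) :
    JointlyMono₂ (S.arrow ≫ prod.fst) (S.arrow ≫ prod.snd) where
  right_cancellation Y f g h₁ h₂ := by
    rw [← cancel_mono S.arrow]
    ext
    · simpa only [Category.assoc] using h₁
    · simpa only [Category.assoc] using h₂

/-- A subobject of `X ⨯ X` is an internal equivalence relation as soon as it induces an
equivalence relation on the generalised elements of `X`. -/
theorem isEquivalenceRelation_of_rel {X : C} (S : Subobject (X ⨯ X))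
    (hS : ∀ T : C, Equivalence (fun x y : T ⟶ X => RelOf S x y)) :
    IsEquivalenceRelation (S.arrow ≫ prod.fst) (S.arrow ≫ prod.snd) := by
  set p₁ := S.arrow ≫ prod.fst with hp₁
  set p₂ := S.arrow ≫ prod.snd with hp₂
  have h0 : RelOf S p₁ p₂ := relOf_arrow S
  obtain ⟨r, r1, r2⟩ := (relOf_iff S _ _).1 ((hS X).refl (𝟙 X))
  obtain ⟨s, s1, s2⟩ := (relOf_iff S _ _).1 ((hS _).symm h0)
  have h1 : RelOf S (pullback.fst p₂ p₁ ≫ p₁) (pullback.fst p₂ p₁ ≫ p₂) := relOf_comp _ h0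
  have h2 : RelOf S (pullback.snd p₂ p₁ ≫ p₁) (pullback.snd p₂ p₁ ≫ p₂) := relOf_comp _ h0
  rw [← pullback.condition] at h2
  obtain ⟨t, t1, t2⟩ := (relOf_iff S _ _).1 ((hS _).trans h1 h2)
  exact ⟨⟨{ toJointlyMono₂ := jointlyMono S
            r := r, reflexivity₁ := r1, reflexivity₂ := r2
            s := s, symmetry₁ := s1, symmetry₂ := s2
            c := PullbackCone.mk _ _ pullback.condition
            isLimit := pullbackIsPullback p₂ p₁
            t := t, transitivity₁ := t1, transitivity₂ := t2 }⟩⟩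

namespace EqRel

/-- `x R y` for generalised elements `x, y : T ⟶ X`. -/
def Rel {X : C} (R : EqRel X) {T : C} (x y : T ⟶ X) : Prop := RelOf R.sub x y

/-- The object of `C` underlying an equivalence relation. -/
noncomputable def obj {X : C} (R : EqRel X) : C := (R.sub : C)

/-- The first projection. -/
noncomputable def fst {X : C} (R : EqRel X) : R.obj ⟶ X := R.sub.arrow ≫ prod.fst

/-- The second projection. -/
noncomputable def snd {X : C} (R : EqRel X) : R.obj ⟶ X := R.sub.arrow ≫ prod.snd

theorem equivalence {X : C} (R : EqRel X) (T : C) :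
    Equivalence (fun x y : T ⟶ X => R.Rel x y) := by
  obtain ⟨⟨e⟩⟩ := R.isEquivalenceRelation
  refine ⟨fun x => ?_, fun {x y} hxy => ?_, fun {x y z} hxy hyz => ?_⟩
  · exact (relOf_iff _ _ _).2 ⟨x ≫ e.r, by simp [e.reflexivity₁], by simp [e.reflexivity₂]⟩
  · obtain ⟨h, h1, h2⟩ := (relOf_iff _ _ _).1 hxy
    exact (relOf_iff _ _ _).2 ⟨h ≫ e.s, by rw [Category.assoc, e.symmetry₁, h2],
      by rw [Category.assoc, e.symmetry₂, h1]⟩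
  · obtain ⟨h, h1, h2⟩ := (relOf_iff _ _ _).1 hxy
    obtain ⟨k, k1, k2⟩ := (relOf_iff _ _ _).1 hyz
    let l := PullbackCone.IsLimit.lift e.isLimit h k (by rw [h2, k1])
    have l1 : l ≫ e.c.fst = h := PullbackCone.IsLimit.lift_fst _ _ _ _
    have l2 : l ≫ e.c.snd = k := PullbackCone.IsLimit.lift_snd _ _ _ _
    refine (relOf_iff _ _ _).2 ⟨l ≫ e.t, ?_, ?_⟩
    · rw [Category.assoc, e.transitivity₁, ← Category.assoc, l1, h1]
    · rw [Category.assoc, e.transitivity₂, ← Category.assoc, l2, k2]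

/-- Equivalence relations on `X` are ordered as subobjects of `X ⨯ X`. -/
noncomputable instance (X : C) : PartialOrder (EqRel X) :=
  PartialOrder.lift EqRel.sub (fun _ _ h => EqRel.ext h)

theorem le_iff {X : C} {R S : EqRel X} :
    R ≤ S ↔ ∀ (T : C) (x y : T ⟶ X), R.Rel x y → S.Rel x y :=
  sub_le_iff R.sub S.sub

/-- The intersection of two equivalence relations. -/
noncomputable def meet {X : C} (R S : EqRel X) : EqRel X where
  sub := R.sub ⊓ S.sub
  isEquivalenceRelation := isEquivalenceRelation_of_rel _ fun T => by
    simp only [RelOf, Subobject.inf_factors]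
    exact ⟨fun x => ⟨(R.equivalence T).refl x, (S.equivalence T).refl x⟩,
      fun h => ⟨(R.equivalence T).symm h.1, (S.equivalence T).symm h.2⟩,
      fun h k => ⟨(R.equivalence T).trans h.1 k.1, (S.equivalence T).trans h.2 k.2⟩⟩

/-- The largest equivalence relation `X ⨯ X`. -/
noncomputable def all (X : C) : EqRel X where
  sub := ⊤
  isEquivalenceRelation := isEquivalenceRelation_of_rel _ fun T => by
    simp only [RelOf, Subobject.top_factors]
    exact ⟨fun _ => trivial, fun _ => trivial, fun _ _ => trivial⟩

/-- The smallest equivalence relation, the diagonal of `X`. -/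
noncomputable def diagonal (X : C) : EqRel X where
  sub := Subobject.mk (diag X)
  isEquivalenceRelation := isEquivalenceRelation_of_rel _ fun T => by
    have key : ∀ x y : T ⟶ X, RelOf (Subobject.mk (diag X)) x y ↔ x = y := by
      intro x y
      unfold RelOf
      rw [mk_factors_iff']
      constructor
      · rintro ⟨h, hh⟩
        have h1 := congrArg (· ≫ prod.fst) hh
        have h2 := congrArg (· ≫ prod.snd) hh
        simp only [Category.assoc, diag, prod.lift_fst, prod.lift_snd, Category.comp_id] at h1 h2
        exact h1.symm.trans h2
      · rintro rfl
        exact ⟨x, by simp⟩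
    simp only [key]
    exact eq_equivalence

end EqRel

/-! ### The parallelistic double equivalence relation -/

/-- The subobject of `R × R` underlying `R □ S`, which is the pullback of the inclusion of `S × S`
into `X⁴` along the morphism `⟨r₁ × r₁, r₂ × r₂⟩` from `R × R` to `X⁴`. -/
noncomputable def squareSub {X : C} (R S : EqRel X) : Subobject (R.obj ⨯ R.obj) :=
  (Subobject.pullback (prod.lift (prod.map R.fst R.fst) (prod.map R.snd R.snd))).obj
    (Subobject.mk (prod.map S.sub.arrow S.sub.arrow))

/-- Two elements `(x, t)` and `(y, z)` of `R` are related by `R □ S` when `x S y` and `t S z`. -/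
theorem relOf_squareSub {X : C} (R S : EqRel X) {T : C} (a b : T ⟶ R.obj) :
    RelOf (squareSub R S) a b ↔
      S.Rel (a ≫ R.fst) (b ≫ R.fst) ∧ S.Rel (a ≫ R.snd) (b ≫ R.snd) := by
  unfold RelOf squareSub
  rw [Limits.pullback_factors_iff, mk_factors_iff']
  simp only [EqRel.Rel, relOf_iff]
  have e1 : prod.lift a b ≫ prod.lift (prod.map R.fst R.fst) (prod.map R.snd R.snd) =
      prod.lift (prod.lift (a ≫ R.fst) (b ≫ R.fst)) (prod.lift (a ≫ R.snd) (b ≫ R.snd)) := by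
    rw [prod.comp_lift, prod.lift_map, prod.lift_map]
  rw [e1]
  constructor
  · rintro ⟨h, hh⟩
    have h1 := congrArg (fun k => k ≫ prod.fst) hh
    have h2 := congrArg (fun k => k ≫ prod.snd) hh
    simp only [Category.assoc, prod.map_fst, prod.map_snd, prod.lift_fst, prod.lift_snd] at h1 h2
    refine ⟨⟨h ≫ prod.fst, ?_, ?_⟩, ⟨h ≫ prod.snd, ?_, ?_⟩⟩
    · simpa only [Category.assoc, prod.lift_fst] using congrArg (fun k => k ≫ prod.fst) h1
    · simpa only [Category.assoc, prod.lift_snd] using congrArg (fun k => k ≫ prod.snd) h1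
    · simpa only [Category.assoc, prod.lift_fst] using congrArg (fun k => k ≫ prod.fst) h2
    · simpa only [Category.assoc, prod.lift_snd] using congrArg (fun k => k ≫ prod.snd) h2
  · rintro ⟨⟨h, h1, h2⟩, ⟨k, k1, k2⟩⟩
    refine ⟨prod.lift h k, ?_⟩
    rw [prod.lift_map]
    congr 1
    · rw [← h1, ← h2, ← prod.comp_lift, ← prod.comp_lift, prod.lift_fst_snd, Category.comp_id]
    · rw [← k1, ← k2, ← prod.comp_lift, ← prod.comp_lift, prod.lift_fst_snd, Category.comp_id]

/-- `R □ S`, as an equivalence relation on (the object underlying) `R`. -/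
noncomputable def square {X : C} (R S : EqRel X) : EqRel R.obj where
  sub := squareSub R S
  isEquivalenceRelation := isEquivalenceRelation_of_rel _ fun T => by
    simp only [relOf_squareSub]
    exact ⟨fun x => ⟨(S.equivalence T).refl _, (S.equivalence T).refl _⟩,
      fun h => ⟨(S.equivalence T).symm h.1, (S.equivalence T).symm h.2⟩,
      fun h k => ⟨(S.equivalence T).trans h.1 k.1, (S.equivalence T).trans h.2 k.2⟩⟩

/-! ### The parallelistic threefold equivalence relation -/

/-- The category of reflexive graphs in `D`. -/
abbrev RGrph (D : Type*) [Category* D] := WalkingReflexivePair ⥤ D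

/-- The set of ends in one direction of a `2ⁿ`-matrix: a single one at the vertex `zero`
(the object of vertices of a reflexive graph), two at `one` (the object of edges). -/
def Ends : WalkingReflexivePair → Type
  | .zero => Unit
  | .one => Bool

instance (a : WalkingReflexivePair) : Fintype (Ends a) :=
  match a with
  | .zero => inferInstanceAs (Fintype Unit)
  | .one => inferInstanceAs (Fintype Bool)

/-- The contravariant action on ends: `left` picks `false`, `right` picks `true`. -/
def Ends.map : ∀ {a b : WalkingReflexivePair}, (a ⟶ b) → Ends b → Ends a
  | _, _, .left, _ => false
  | _, _, .right, _ => true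
  | _, _, .reflexion, _ => ()
  | _, _, .leftCompReflexion, _ => false
  | _, _, .rightCompReflexion, _ => true
  | _, _, .id _, x => x

theorem Ends.map_id {a : WalkingReflexivePair} (x : Ends a) : Ends.map (𝟙 a) x = x := rfl

theorem Ends.map_comp {a b c : WalkingReflexivePair} (f : a ⟶ b) (g : b ⟶ c) (x : Ends c) :
    Ends.map (f ≫ g) x = Ends.map f (Ends.map g x) := by
  change WalkingReflexivePair.Hom a b at f
  change WalkingReflexivePair.Hom b c at g
  cases f <;> cases g <;> rfl

/-- The shape of an entry of a matrix over the triple of vertices `a`. -/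
abbrev Entry (a : WalkingReflexivePair × WalkingReflexivePair × WalkingReflexivePair) : Type :=
  Ends a.1 × Ends a.2.1 × Ends a.2.2

/-- The action on entries. -/
def Entry.map {a b : WalkingReflexivePair × WalkingReflexivePair × WalkingReflexivePair}
    (f : a ⟶ b) (p : Entry b) : Entry a :=
  (Ends.map f.1 p.1, Ends.map f.2.1 p.2.1, Ends.map f.2.2 p.2.2)

/-- The two entries differ at most in the direction `i`, where the outermost (first) direction is
numbered `2`, the middle one `1`, and the innermost (last) one `0`. -/
def Aligned (i : Fin 3) {a : WalkingReflexivePair × WalkingReflexivePair × WalkingReflexivePair}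
    (p q : Entry a) : Prop :=
  (i ≠ 2 → p.1 = q.1) ∧ (i ≠ 1 → p.2.1 = q.2.1) ∧ (i ≠ 0 → p.2.2 = q.2.2)

theorem Aligned.map {i : Fin 3}
    {a b : WalkingReflexivePair × WalkingReflexivePair × WalkingReflexivePair}
    (f : a ⟶ b) {p q : Entry b} (h : Aligned i p q) :
    Aligned i (Entry.map f p) (Entry.map f q) :=
  ⟨fun hi => congrArg (Ends.map f.1) (h.1 hi), fun hi => congrArg (Ends.map f.2.1) (h.2.1 hi),
    fun hi => congrArg (Ends.map f.2.2) (h.2.2 hi)⟩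

section Box

variable {X : C} (R : Fin 3 → EqRel X)

open Classical in
/-- The subobject of a power of `X` of all the matrices whose entries aligned in the direction `i`
are related by `R i`, for each `i`. -/
noncomputable def boxSub
    (a : WalkingReflexivePair × WalkingReflexivePair × WalkingReflexivePair) :
    Subobject (∏ᶜ fun _ : Entry a => X) :=
  (Finset.univ.filter fun e : Fin 3 × Entry a × Entry a => Aligned e.1 e.2.1 e.2.2).inf fun e =>
    (Subobject.pullback (prod.lift (Pi.π _ e.2.1) (Pi.π _ e.2.2))).obj (R e.1).sub

theorem boxSub_factors {a : WalkingReflexivePair × WalkingReflexivePair × WalkingReflexivePair}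
    {T : C} (m : T ⟶ ∏ᶜ fun _ : Entry a => X) :
    (boxSub R a).Factors m ↔
      ∀ (i : Fin 3) (p q : Entry a), Aligned i p q → (R i).Rel (m ≫ Pi.π _ p) (m ≫ Pi.π _ q) := by
  classical
  unfold boxSub
  rw [Subobject.finset_inf_factors]
  simp only [Finset.mem_filter, Finset.mem_univ, true_and, Limits.pullback_factors_iff,
    prod.comp_lift, Prod.forall, EqRel.Rel, RelOf]

/-- Reindexing of matrices. -/
noncomputable def reindex (X : C)
    {a b : WalkingReflexivePair × WalkingReflexivePair × WalkingReflexivePair} (f : a ⟶ b) :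
    (∏ᶜ fun _ : Entry a => X) ⟶ ∏ᶜ fun _ : Entry b => X :=
  Pi.lift fun p => Pi.π _ (Entry.map f p)

theorem reindex_factors
    {a b : WalkingReflexivePair × WalkingReflexivePair × WalkingReflexivePair} (f : a ⟶ b) :
    (boxSub R b).Factors ((boxSub R a).arrow ≫ reindex X f) := by
  rw [boxSub_factors]
  intro i p q h
  have := (boxSub_factors R _).1 (Subobject.factors_self (boxSub R a)) i _ _ (h.map f)
  simpa [reindex] using this

/-- The matrix description of the parallelistic threefold equivalence relation on `R 0`, `R 1`,
`R 2`, as a functor of three variables. -/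
noncomputable def boxFunctor :
    (WalkingReflexivePair × WalkingReflexivePair × WalkingReflexivePair) ⥤ C where
  obj a := (boxSub R a : C)
  map f := (boxSub R _).factorThru ((boxSub R _).arrow ≫ reindex X f) (reindex_factors R f)
  map_id a := by
    rw [← cancel_mono (boxSub R a).arrow, Subobject.factorThru_arrow]
    have : reindex X (𝟙 a) = 𝟙 _ := by
      refine Pi.hom_ext _ _ fun p => ?_
      simp only [reindex, Pi.lift_π, Category.id_comp]
      rfl
    rw [this, Category.comp_id, Category.id_comp]
  map_comp {a b c} f g := by
    rw [← cancel_mono (boxSub R c).arrow, Category.assoc, Subobject.factorThru_arrow,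
      Subobject.factorThru_arrow, ← Category.assoc, Subobject.factorThru_arrow, Category.assoc]
    congr 1
    refine Pi.hom_ext _ _ fun p => ?_
    simp only [reindex, Category.assoc, Pi.lift_π]
    congr 1
    simp [Entry.map, Ends.map_comp]

/-- The parallelistic threefold equivalence relation on `R 0`, `R 1`, `R 2`, as a threefold
reflexive graph; the outermost direction is the one of `R 2`. -/
noncomputable def box : RGrph (RGrph (RGrph C)) :=
  Functor.curry.obj (boxFunctor R) ⋙ Functor.curry

end Box

/-! ### Cubic extensions -/

/-- Given a class `E` of morphisms, the class of the commutative squares (seen as morphisms in the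
category of arrows) all of whose edges are in `E`, and whose comparison morphism to the induced
pullback is in `E` as well. -/
def DoubleExtension {D : Type*} [Category* D] [HasPullbacks D] (E : MorphismProperty D) :
    MorphismProperty (Arrow D) := fun f g φ =>
  E f.hom ∧ E g.hom ∧ E φ.left ∧ E φ.right ∧
    E (pullback.lift f.hom φ.left φ.w.symm : f.left ⟶ pullback φ.right g.hom)

/-- The `1`-cubic extensions are the regular epimorphisms, the `2`-cubic extensions the double
extensions with respect to those, and the `3`-cubic extensions the double extensions with respect
to the `2`-cubic ones. An object of `Arrow (Arrow (Arrow C))` is a cube in `C`. -/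
def IsThreeCubicExtension (F : Arrow (Arrow (Arrow C))) : Prop :=
  DoubleExtension (DoubleExtension (MorphismProperty.regularEpi C)) F.hom

end Relations

/-! ### The lattice of equivalence relations -/

section Lattice

variable {C : Type u} [Category.{v} C] [Regular C] [Maltsev C]

namespace EqRel

/-- The span from `X` to `X` which composes `R` with `S`. -/
noncomputable def compSpan {X : C} (R S : EqRel X) : pullback R.snd S.fst ⟶ X ⨯ X :=
  prod.lift (pullback.fst _ _ ≫ R.fst) (pullback.snd _ _ ≫ S.snd)

theorem rel_imageSubobject {X : C} (R S : EqRel X) {T : C} {x y z : T ⟶ X}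
    (hxy : R.Rel x y) (hyz : S.Rel y z) : RelOf (imageSubobject (compSpan R S)) x z := by
  obtain ⟨h, h1, h2⟩ := (relOf_iff _ _ _).1 hxy
  obtain ⟨k, k1, k2⟩ := (relOf_iff _ _ _).1 hyz
  let l : T ⟶ pullback R.snd S.fst := pullback.lift h k (h2.trans k1.symm)
  have e : (l ≫ factorThruImageSubobject (compSpan R S)) ≫
      (imageSubobject (compSpan R S)).arrow = prod.lift x z := by
    rw [Category.assoc, imageSubobject_arrow_comp, compSpan, prod.comp_lift, ← Category.assoc,
      ← Category.assoc, show l ≫ pullback.fst _ _ = h from pullback.lift_fst _ _ _,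
      show l ≫ pullback.snd _ _ = k from pullback.lift_snd _ _ _]
    exact congrArg₂ prod.lift h1 k2
  unfold RelOf
  rw [← e]
  exact Subobject.factors_comp_arrow _

/-- The join of two equivalence relations, which is their composite: the regular image in `X ⨯ X`
of the pullback of `R` and `S` over `X`. -/
noncomputable def join {X : C} (R S : EqRel X) : EqRel X where
  sub := imageSubobject (compSpan R S)
  isEquivalenceRelation := by
    obtain ⟨r, r1, r2⟩ := (relOf_iff _ _ _).1
      (rel_imageSubobject R S ((R.equivalence X).refl (𝟙 X)) ((S.equivalence X).refl (𝟙 X)))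
    exact Maltsev.isEquivalenceRelation _ _
      { toJointlyMono₂ := jointlyMono _
        r := r, reflexivity₁ := r1, reflexivity₂ := r2 }

theorem join_le {X : C} {R S Q : EqRel X} (hR : R ≤ Q) (hS : S ≤ Q) : join R S ≤ Q := by
  have h1 : Q.Rel (pullback.fst R.snd S.fst ≫ R.fst) (pullback.fst R.snd S.fst ≫ R.snd) :=
    le_iff.1 hR _ _ _ (relOf_comp _ (relOf_arrow R.sub))
  have h2 : Q.Rel (pullback.snd R.snd S.fst ≫ S.fst) (pullback.snd R.snd S.fst ≫ S.snd) :=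
    le_iff.1 hS _ _ _ (relOf_comp _ (relOf_arrow S.sub))
  rw [← pullback.condition] at h2
  have h3 : Q.sub.Factors (compSpan R S) := (Q.equivalence _).trans h1 h2
  exact imageSubobject_le _ (Q.sub.factorThru _ h3) (Q.sub.factorThru_arrow _ h3)

/-- The lattice of equivalence relations on `X`. -/
noncomputable instance (X : C) : Lattice (EqRel X) where
  inf := meet
  inf_le_left R S := (inf_le_left : R.sub ⊓ S.sub ≤ R.sub)
  inf_le_right R S := (inf_le_right : R.sub ⊓ S.sub ≤ S.sub)
  le_inf R S Q h k := (le_inf h k : R.sub ≤ S.sub ⊓ Q.sub)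
  sup := join
  le_sup_left R S := le_iff.2 fun T _ y h => rel_imageSubobject R S h ((S.equivalence T).refl y)
  le_sup_right R S := le_iff.2 fun T x _ h => rel_imageSubobject R S ((R.equivalence T).refl x) h
  sup_le _ _ _ h k := join_le h k

noncomputable instance (X : C) : BoundedOrder (EqRel X) where
  top := all X
  le_top R := (le_top : R.sub ≤ ⊤)
  bot := diagonal X
  bot_le R := by
    have h : R.sub.Factors (diag X) := (R.equivalence X).refl (𝟙 X)
    exact Subobject.mk_le_of_comm (R.sub.factorThru _ h) (R.sub.factorThru_arrow _ h)

end EqRel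

/-- A finite collection of equivalence relations is distributive. The empty meet is `X × X`. -/
def Distributive {X : C} {n : ℕ} (R : Fin n → EqRel X) : Prop :=
  ∀ (k : ℕ) (J : Fin (k + 1) → Finset (Fin n)), 1 ≤ k → (∀ i j, i ≠ j → Disjoint (J i) (J j)) →
    (J 0).inf R ⊓ Finset.univ.sup (fun i : Fin k => (J i.succ).inf R) =
      Finset.univ.sup (fun i : Fin k => (J 0 ∪ J i.succ).inf R)

/-- A threefold reflexive graph is a distributive parallelistic threefold equivalence relation when
it is isomorphic to the one on a distributive triple of equivalence relations. -/
def IsDistributiveParallelistic (G : RGrph (RGrph (RGrph C))) : Prop :=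
  ∃ (X : C) (R : Fin 3 → EqRel X), Nonempty (G ≅ box R) ∧ Distributive R

end Lattice

/-! ### The induced threefold regular epimorphism -/

section Coequaliser

/-- The functor sending a reflexive graph to its coequaliser. -/
noncomputable def Coeq (D : Type*) [Category* D] [HasColimitsOfShape WalkingReflexivePair D] :
    RGrph D ⥤ Arrow D where
  obj G := Arrow.mk (colimit.ι G WalkingReflexivePair.zero)
  map φ := Arrow.homMk (φ.app WalkingReflexivePair.zero) (colimMap φ) (by simp)

variable (C : Type u) [Category.{v} C]

/-- In an exact Mal'tsev category every reflexive graph has a coequaliser. -/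
instance hasReflexiveCoequalizers [BarrExact C] [Maltsev C] : HasReflexiveCoequalizers C where
  has_coeq A B f g _ := by
    let m := image.ι (prod.lift f g)
    let e := factorThruImage (prod.lift f g)
    have hem : e ≫ m = prod.lift f g := image.fac _
    have hf : e ≫ m ≫ prod.fst = f := by rw [← Category.assoc, hem, prod.lift_fst]
    have hg : e ≫ m ≫ prod.snd = g := by rw [← Category.assoc, hem, prod.lift_snd]
    have hrel : ReflexiveRelation (m ≫ prod.fst) (m ≫ prod.snd) :=
      { right_cancellation := fun Y a b h₁ h₂ => by
          rw [← cancel_mono m]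
          ext <;> simpa
        r := commonSection f g ≫ e
        reflexivity₁ := by rw [Category.assoc, hf, section_comp_left]
        reflexivity₂ := by rw [Category.assoc, hg, section_comp_right] }
    obtain ⟨⟨q⟩⟩ := BarrExact.effective _ _ (Maltsev.isEquivalenceRelation _ _ hrel)
    have : Epi e := inferInstance
    have hc := isCoequalizerEpiComp q.isCoequalizer e
    have : HasCoequalizer (e ≫ m ≫ prod.fst) (e ≫ m ≫ prod.snd) := ⟨⟨⟨_, hc⟩⟩⟩
    rwa [hf, hg] at this

instance hasColimitsOfShape [BarrExact C] [Maltsev C] :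
    HasColimitsOfShape WalkingReflexivePair C :=
  hasReflexiveCoequalizers_iff.2 inferInstance

/-- The coequaliser of a threefold reflexive graph: the coequaliser is taken in the outermost
direction first, and then in the others. -/
noncomputable def Coeq₃ [HasColimitsOfShape WalkingReflexivePair C] :
    RGrph (RGrph (RGrph C)) ⥤ Arrow (Arrow (Arrow C)) :=
  Coeq (RGrph (RGrph C)) ⋙ (Coeq (RGrph C) ⋙ (Coeq C).mapArrow).mapArrow

/-- The threefold regular epimorphism induced by three equivalence relations on `X`. -/
noncomputable def inducedCube {C : Type u} [Category.{v} C] [BarrExact C] [Maltsev C] {X : C}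
    (R : Fin 3 → EqRel X) : Arrow (Arrow (Arrow C)) :=
  (Coeq₃ C).obj (box R)

end Coequaliser

end ExactMaltsev

/-!
The proof works with generalised elements `x : T ⟶ X`: equivalence relations are relations between
these, a regular epimorphism is a morphism along which elements lift after passing to a cover
(`exists_cover_lift`), and being related is a local property (`EqRel.rel_of_cover`). As the join of
two equivalence relations is their composite (`EqRel.sup_rel`), the lattice of equivalence
relations is modular, and in a modular lattice each distributive law for a triple of elements
implies all the others (`sup_inf_eq_of_inf_sup_eq`, `inf_sup_eq_of_sup_inf_eq`). The general notion
of a distributive family of three relations reduces to these laws (`distributive_iff_forall`).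
The equations for `R □ (S ⊔ Q)` are compared with the distributive laws by chasing elements
(`square_sup`, `inf_sup_of_square_sup`).

For the cube, each of its vertices is the quotient of `X` by the join of the relations in the
directions that have been coequalised (`IsQuotient.comp_colimit`). In a square of quotients of `X`
by `⊥`, `S₁`, `S₂` and `S`, where `S₁ ≤ S` and `S₂ ≤ S`, the comparison morphism to the pullback is
a regular epimorphism exactly when `S ≤ S₁ ⊔ S₂` (`isRegularEpi_comparison_iff`). Therefore all
faces of the cube are double extensions. The comparison morphism of the whole cube is itself such
a square: its vertices are the quotients of `X` by `⊥`, by `R₀`, by `R₁ ⊓ R₂`, and by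
`(R₀ ⊔ R₁) ⊓ (R₀ ⊔ R₂)`, as the kernel pair of a morphism to a pullback is a meet. It is a double
extension exactly when `(R₀ ⊔ R₁) ⊓ (R₀ ⊔ R₂) ≤ R₀ ⊔ R₁ ⊓ R₂`, which is a distributive law
(`isThreeCubicExtension_iff`). That a threefold reflexive graph isomorphic to a distributive one is
distributive follows, since `3`-cubic extensions are invariant under isomorphism.
-/

namespace ExactMaltsev

/-! ### Regular epimorphisms as covers -/

section Regular

variable {C : Type u} [Category.{v} C] [Regular C]

theorem isRegularEpi_comp {X Y Z : C} (f : X ⟶ Y) (g : Y ⟶ Z) [IsRegularEpi f]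
    [IsRegularEpi g] : IsRegularEpi (f ≫ g) := by
  have : StrongEpi (f ≫ g) := strongEpi_comp f g
  infer_instance

theorem isRegularEpi_of_comp {X Y Z : C} (f : X ⟶ Y) (g : Y ⟶ Z) [IsRegularEpi (f ≫ g)] :
    IsRegularEpi g := by
  have : StrongEpi g := strongEpi_of_strongEpi f g
  infer_instance

theorem isRegularEpi_of_fac {X Y Z : C} {f : X ⟶ Y} {g : Y ⟶ Z} {h : X ⟶ Z} (w : f ≫ g = h)
    [IsRegularEpi h] : IsRegularEpi g := by
  subst w
  exact isRegularEpi_of_comp f g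

/-- Generalised elements lift along a regular epimorphism after passing to a cover. -/
theorem exists_cover_lift {X V T : C} (q : X ⟶ V) [IsRegularEpi q] (a : T ⟶ V) :
    ∃ (T' : C) (e : T' ⟶ T) (x : T' ⟶ X), IsRegularEpi e ∧ x ≫ q = e ≫ a :=
  ⟨_, pullback.snd q a, pullback.fst q a, inferInstance, pullback.condition⟩

namespace EqRel

theorem rel_comp {X : C} (R : EqRel X) {T T' : C} (e : T' ⟶ T) {x y : T ⟶ X} (h : R.Rel x y) :
    R.Rel (e ≫ x) (e ≫ y) :=
  relOf_comp e h

theorem rel_refl {X : C} (R : EqRel X) {T : C} (x : T ⟶ X) : R.Rel x x :=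
  (R.equivalence T).refl x

theorem Rel.symm {X : C} {R : EqRel X} {T : C} {x y : T ⟶ X} (h : R.Rel x y) : R.Rel y x :=
  (R.equivalence T).symm h

theorem Rel.trans {X : C} {R : EqRel X} {T : C} {x y z : T ⟶ X} (h : R.Rel x y)
    (k : R.Rel y z) : R.Rel x z :=
  (R.equivalence T).trans h k

theorem Rel.mono {X : C} {R S : EqRel X} (hRS : R ≤ S) {T : C} {x y : T ⟶ X} (h : R.Rel x y) :
    S.Rel x y :=
  le_iff.1 hRS T x y h

theorem rel_fst_snd {X : C} (R : EqRel X) : R.Rel R.fst R.snd :=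
  relOf_arrow R.sub

theorem rel_iff_exists_lift {X : C} (R : EqRel X) {T : C} {x y : T ⟶ X} :
    R.Rel x y ↔ ∃ h : T ⟶ R.obj, h ≫ R.fst = x ∧ h ≫ R.snd = y :=
  relOf_iff R.sub x y

/-- Being related is a local property with respect to covers by regular epimorphisms. -/
theorem rel_of_cover {X : C} {R : EqRel X} {T T' : C} (e : T' ⟶ T) [IsRegularEpi e]
    {x y : T ⟶ X} (h : R.Rel (e ≫ x) (e ≫ y)) : R.Rel x y := by
  have h' : R.sub.Factors (e ≫ prod.lift x y) := by
    rw [prod.comp_lift]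
    exact h
  have sq : CommSq (R.sub.factorThru _ h') e R.sub.arrow (prod.lift x y) :=
    ⟨R.sub.factorThru_arrow _ h'⟩
  have : sq.lift ≫ R.sub.arrow = prod.lift x y := sq.fac_right
  unfold Rel RelOf
  rw [← this]
  exact Subobject.factors_comp_arrow _

end EqRel

end Regular

/-! ### The modular lattice of equivalence relations -/

section Lattice

variable {C : Type u} [Category.{v} C] [Regular C] [Maltsev C]

namespace EqRel

theorem inf_rel {X : C} {R S : EqRel X} {T : C} {x y : T ⟶ X} :
    (R ⊓ S).Rel x y ↔ R.Rel x y ∧ S.Rel x y :=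
  Subobject.inf_factors _

theorem bot_rel {X : C} {T : C} {x y : T ⟶ X} : (⊥ : EqRel X).Rel x y ↔ x = y := by
  constructor
  · intro h
    obtain ⟨k, hk⟩ := (mk_factors_iff' (diag X) (prod.lift x y)).1 h
    have h1 := congrArg (· ≫ prod.fst) hk
    have h2 := congrArg (· ≫ prod.snd) hk
    simp only [Category.assoc, diag, prod.lift_fst, prod.lift_snd, Category.comp_id] at h1 h2
    exact h1.symm.trans h2
  · rintro rfl
    exact rel_refl _ _

/-- The join is the composite of relations: two elements are related by `R ⊔ S` when, on some
cover, they are linked through an intermediate element. -/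
theorem sup_rel {X : C} {R S : EqRel X} {T : C} {x z : T ⟶ X} :
    (R ⊔ S).Rel x z ↔ ∃ (T' : C) (e : T' ⟶ T) (y : T' ⟶ X), IsRegularEpi e ∧
      R.Rel (e ≫ x) y ∧ S.Rel y (e ≫ z) := by
  constructor
  · intro h
    have h' : (imageSubobject (compSpan R S)).Factors (prod.lift x z) := h
    have : StrongEpi (factorThruImageSubobject (compSpan R S)) := strongEpi_comp _ _
    obtain ⟨T', e, k, he, hk⟩ := exists_cover_lift (factorThruImageSubobject (compSpan R S))
      ((imageSubobject (compSpan R S)).factorThru _ h')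
    have hk' := congrArg (· ≫ (imageSubobject (compSpan R S)).arrow) hk
    simp only [Category.assoc, imageSubobject_arrow_comp, Subobject.factorThru_arrow] at hk'
    have h1 := congrArg (· ≫ prod.fst) hk'
    have h2 := congrArg (· ≫ prod.snd) hk'
    simp only [compSpan, Category.assoc, prod.lift_fst, prod.lift_snd] at h1 h2
    refine ⟨T', e, k ≫ pullback.fst _ _ ≫ R.snd, he, ?_, ?_⟩
    · rw [← h1, ← Category.assoc, ← Category.assoc]
      exact rel_comp _ _ R.rel_fst_snd
    · rw [← h2, pullback.condition, ← Category.assoc, ← Category.assoc]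
      exact rel_comp _ _ S.rel_fst_snd
  · rintro ⟨T', e, y, he, h1, h2⟩
    exact rel_of_cover e ((h1.mono le_sup_left).trans (h2.mono le_sup_right))

instance isModularLattice (X : C) : IsModularLattice (EqRel X) where
  sup_inf_le_assoc_of_le {R} S {Q} hRQ := by
    refine le_iff.2 fun T x y h => ?_
    obtain ⟨h1, h2⟩ := inf_rel.1 h
    obtain ⟨T', e, z, he, hx, hy⟩ := sup_rel.1 h1
    exact sup_rel.2 ⟨T', e, z, he, hx,
      inf_rel.2 ⟨hy, ((hx.mono hRQ).symm).trans (rel_comp _ e h2)⟩⟩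

end EqRel

end Lattice

section ModularLattice

variable {α : Type*} [Lattice α] [IsModularLattice α] {a b c : α}

/-- In a modular lattice, distributivity of a triple in one form implies it in the dual form with
another element of the triple singled out. -/
theorem sup_inf_eq_of_inf_sup_eq (h : a ⊓ (b ⊔ c) = a ⊓ b ⊔ a ⊓ c) :
    b ⊔ a ⊓ c = (b ⊔ a) ⊓ (b ⊔ c) := by
  rw [sup_inf_assoc_of_le a (le_sup_left : b ≤ b ⊔ c), h, ← sup_assoc,
    sup_eq_left.2 (inf_le_right : a ⊓ b ≤ b)]

theorem inf_sup_eq_of_sup_inf_eq (h : a ⊔ b ⊓ c = (a ⊔ b) ⊓ (a ⊔ c)) :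
    b ⊓ (a ⊔ c) = b ⊓ a ⊔ b ⊓ c :=
  sup_inf_eq_of_inf_sup_eq (α := αᵒᵈ) h

/-- In a modular lattice, distributivity of a triple does not depend on the element of the triple
that is singled out. -/
theorem inf_sup_eq_rotate (h : a ⊓ (b ⊔ c) = a ⊓ b ⊔ a ⊓ c) :
    c ⊓ (a ⊔ b) = c ⊓ a ⊔ c ⊓ b := by
  have h' := sup_inf_eq_of_inf_sup_eq h
  rw [inf_comm a c, inf_comm (b ⊔ a)] at h'
  have h'' := inf_sup_eq_of_sup_inf_eq h'
  rwa [sup_comm b a, sup_comm (c ⊓ b)] at h''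

end ModularLattice

section Distributive

variable {C : Type u} [Category.{v} C] [Regular C] [Maltsev C] {X : C}

/-- Distributivity of a triple only has content when `J 0` is a singleton and there are two more
blocks, which are the other two singletons. -/
theorem distributive_iff_forall {R : Fin 3 → EqRel X} :
    Distributive R ↔ ∀ i j k : Fin 3, i ≠ j → i ≠ k → j ≠ k →
      R i ⊓ (R j ⊔ R k) = R i ⊓ R j ⊔ R i ⊓ R k := by
  constructor
  · intro h i j k hij hik hjk
    have := h 2 ![{i}, {j}, {k}] (by norm_num) (by
      intro a b hab
      fin_cases a <;> fin_cases b <;> simp_all [eq_comm])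
    simpa [Fin.univ_succ, Finset.inf_union] using this
  · intro h k J hk hJ
    have hle : Finset.univ.sup (fun i : Fin k => (J 0 ∪ J i.succ).inf R) ≤
        (J 0).inf R ⊓ Finset.univ.sup (fun i : Fin k => (J i.succ).inf R) :=
      Finset.sup_le fun i hi => le_inf (Finset.inf_mono Finset.subset_union_left)
        ((Finset.inf_mono Finset.subset_union_right).trans
          (Finset.le_sup (f := fun i : Fin k => (J i.succ).inf R) hi))
    refine le_antisymm ?_ hle
    by_cases hne : ∀ i, (J i).Nonempty
    · choose f hf using hne
      have hinj : Function.Injective f := fun i j hij => by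
        by_contra hne
        exact Finset.disjoint_left.1 (hJ i j hne) (hf i) (hij ▸ hf j)
      have hk2 : k < 3 := by simpa using Fintype.card_le_of_injective f hinj
      interval_cases k
      · simp [Finset.inf_union]
      · have hsurj : Function.Surjective f := Finite.surjective_of_injective hinj
        -- Three disjoint nonempty subsets of a set with three elements are singletons.
        have hsing : ∀ i, J i = {f i} := fun i => by
          refine Finset.eq_singleton_iff_unique_mem.2 ⟨hf i, fun x hx => ?_⟩
          obtain ⟨j, rfl⟩ := hsurj x
          by_contra hne
          exact Finset.disjoint_left.1 (hJ j i fun hji => hne (hji ▸ rfl)) (hf j) hx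
        have := h (f 0) (f 1) (f 2) (hinj.ne (by decide)) (hinj.ne (by decide))
          (hinj.ne (by decide))
        simp only [hsing]
        simpa [Fin.univ_succ, Finset.inf_union] using this.le
    · push Not at hne
      obtain ⟨i, hi⟩ := hne
      rcases Fin.eq_zero_or_eq_succ i with rfl | ⟨j, rfl⟩
      · simp [hi]
      · refine inf_le_left.trans ?_
        have := Finset.le_sup (f := fun i : Fin k => (J 0 ∪ J i.succ).inf R) (Finset.mem_univ j)
        simpa only [hi, Finset.union_empty] using this

end Distributive

/-! ### The double equivalence relation `R □ S` and joins -/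

section Square

variable {C : Type u} [Category.{v} C] [Regular C] [Maltsev C] {X : C} {R S Q : EqRel X}

theorem square_rel {C : Type u} [Category.{v} C] [HasFiniteLimits C] {X : C} {R S : EqRel X} {T : C}
    {a b : T ⟶ R.obj} :
    (square R S).Rel a b ↔ S.Rel (a ≫ R.fst) (b ≫ R.fst) ∧ S.Rel (a ≫ R.snd) (b ≫ R.snd) :=
  relOf_squareSub R S a b

theorem square_mono (h : S ≤ Q) : square R S ≤ square R Q :=
  EqRel.le_iff.2 fun _ _ _ hab =>
    square_rel.2 ⟨(square_rel.1 hab).1.mono h, (square_rel.1 hab).2.mono h⟩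

/-- If `x S a Q y` and `t S b Q z` with `x R t` and `y R z`, then `a` and `b` are related by
`(R ⊔ S) ⊓ (R ⊔ Q) = R ⊔ S ⊓ Q`, which allows `b` to be replaced by an element that is related to
`a` by `R`. -/
theorem square_sup (h : R ⊔ S ⊓ Q = (R ⊔ S) ⊓ (R ⊔ Q)) :
    square R (S ⊔ Q) = square R S ⊔ square R Q := by
  refine le_antisymm (EqRel.le_iff.2 fun T p q hpq => ?_)
    (sup_le (square_mono le_sup_left) (square_mono le_sup_right))
  obtain ⟨h1, h2⟩ := square_rel.1 hpq
  obtain ⟨T₁, e₁, a, he₁, ha, ha'⟩ := EqRel.sup_rel.1 h1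
  obtain ⟨T₂, e₂, b, he₂, hb, hb'⟩ := EqRel.sup_rel.1 (EqRel.rel_comp _ e₁ h2)
  replace ha := EqRel.rel_comp _ e₂ ha
  replace ha' := EqRel.rel_comp _ e₂ ha'
  have hp := EqRel.rel_comp _ e₂ (EqRel.rel_comp _ e₁ (EqRel.rel_comp _ p R.rel_fst_snd))
  have hq := EqRel.rel_comp _ e₂ (EqRel.rel_comp _ e₁ (EqRel.rel_comp _ q R.rel_fst_snd))
  have hab : (R ⊔ S ⊓ Q).Rel (e₂ ≫ a) b := by
    rw [h]
    exact EqRel.inf_rel.2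
      ⟨((ha.symm.mono le_sup_right).trans (hp.mono le_sup_left)).trans (hb.mono le_sup_right),
        ((ha'.mono le_sup_right).trans (hq.mono le_sup_left)).trans (hb'.symm.mono le_sup_right)⟩
  obtain ⟨T₃, e₃, c, he₃, hac, hcb⟩ := EqRel.sup_rel.1 hab
  obtain ⟨hcb, hcb'⟩ := EqRel.inf_rel.1 hcb
  obtain ⟨m, hm, hm'⟩ := R.rel_iff_exists_lift.1 hac
  have := isRegularEpi_comp e₂ e₁
  refine EqRel.sup_rel.2 ⟨T₃, e₃ ≫ e₂ ≫ e₁, m, isRegularEpi_comp _ _,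
    square_rel.2 ⟨?_, ?_⟩, square_rel.2 ⟨?_, ?_⟩⟩
  · simpa [hm] using EqRel.rel_comp _ e₃ ha
  · simpa [hm'] using (EqRel.rel_comp _ e₃ hb).trans hcb.symm
  · simpa [hm] using EqRel.rel_comp _ e₃ ha'
  · simpa [hm'] using hcb'.trans (EqRel.rel_comp _ e₃ hb')

/-- If `x R y` and `x (S ⊔ Q) y`, then the elements `(x, x)` and `(x, y)` of `R` are linked by some
`(a, b)`. Here `a` is related to `x` by `Q` and to `b` by `R ⊓ S`, and `b Q y`. Hence
`x (R ⊓ S ⊔ Q) y`, and modularity concludes. -/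
theorem inf_sup_of_square_sup (h : square R (S ⊔ Q) = square R S ⊔ square R Q) :
    R ⊓ (S ⊔ Q) = R ⊓ S ⊔ R ⊓ Q := by
  refine le_antisymm (EqRel.le_iff.2 fun T x y hxy => ?_) le_inf_sup
  obtain ⟨hR, hSQ⟩ := EqRel.inf_rel.1 hxy
  obtain ⟨d, hd, hd'⟩ := R.rel_iff_exists_lift.1 (R.rel_refl x)
  obtain ⟨p, hp, hp'⟩ := R.rel_iff_exists_lift.1 hR
  have hdp : (square R S ⊔ square R Q).Rel d p := by
    rw [← h, square_rel, hd, hd', hp, hp']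
    exact ⟨EqRel.rel_refl _ _, hSQ⟩
  obtain ⟨T', e, m, he, h1, h2⟩ := EqRel.sup_rel.1 hdp
  obtain ⟨h11, h12⟩ := square_rel.1 h1
  obtain ⟨h21, h22⟩ := square_rel.1 h2
  simp only [Category.assoc, hd, hd', hp, hp'] at h11 h12 h21 h22
  have hm : R.Rel (m ≫ R.fst) (m ≫ R.snd) := EqRel.rel_comp _ m R.rel_fst_snd
  have hxb : (R ⊓ S ⊔ Q).Rel (e ≫ x) (e ≫ y) :=
    ((h21.symm.mono le_sup_right).trans
      ((EqRel.inf_rel.2 ⟨hm, h11.symm.trans h12⟩ : (R ⊓ S).Rel _ _).mono le_sup_left)).trans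
      (h22.mono le_sup_right)
  have hmod : (R ⊓ S ⊔ Q) ⊓ R = R ⊓ S ⊔ Q ⊓ R := sup_inf_assoc_of_le Q inf_le_left
  have hfin : ((R ⊓ S ⊔ Q) ⊓ R).Rel (e ≫ x) (e ≫ y) :=
    EqRel.inf_rel.2 ⟨hxb, EqRel.rel_comp _ e hR⟩
  rw [hmod, inf_comm Q R] at hfin
  exact EqRel.rel_of_cover e hfin

end Square

/-! ### Quotients by equivalence relations -/

section Quotient

variable {C : Type u} [Category.{v} C] [BarrExact C] {X : C}

/-- The morphism `q` is a quotient of `X` by `R`: a regular epimorphism with kernel pair `R`. -/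
structure IsQuotient {V : C} (q : X ⟶ V) (R : EqRel X) : Prop where
  isRegularEpi : IsRegularEpi q
  rel_iff {T : C} {x y : T ⟶ X} : R.Rel x y ↔ x ≫ q = y ≫ q

theorem exists_isQuotient (R : EqRel X) :
    ∃ (V : C) (q : X ⟶ V), IsQuotient q R := by
  obtain ⟨⟨e⟩⟩ := BarrExact.effective _ _ R.isEquivalenceRelation
  refine ⟨e.B, e.π, inferInstance, fun {T x y} => ?_⟩
  rw [EqRel.rel_iff_exists_lift]
  constructor
  · rintro ⟨h, rfl, rfl⟩
    rw [Category.assoc, Category.assoc]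
    exact congrArg (h ≫ ·) e.isKernelPair.w
  · intro h
    exact ⟨e.isKernelPair.lift x y h, e.isKernelPair.lift_fst _ _ _,
      e.isKernelPair.lift_snd _ _ _⟩

/-- A morphism that identifies the elements related by `R` factors through the quotient by `R`. -/
theorem IsQuotient.exists_fac {V Z : C} {q : X ⟶ V} {R : EqRel X} (hq : IsQuotient q R)
    {k : X ⟶ Z} (hk : ∀ {T : C} {x y : T ⟶ X}, R.Rel x y → x ≫ k = y ≫ k) :
    ∃ k' : V ⟶ Z, q ≫ k' = k := by
  have := hq.isRegularEpi
  exact ⟨_, IsRegularEpi.fac q k (hk (hq.rel_iff.2 (IsRegularEpi.w q)))⟩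

variable [Maltsev C]

theorem isQuotient_bot {V : C} (q : X ⟶ V) [IsIso q] : IsQuotient q ⊥ :=
  ⟨inferInstance, fun {T x y} => by rw [EqRel.bot_rel, cancel_mono]⟩

/-- The comparison morphism from a square of quotients of `X` to the pullback is a regular
epimorphism if and only if the relation of the terminal vertex is the join of the relations of the
two intermediate ones. -/
theorem isRegularEpi_comparison_iff {V V₁ V₂ W P : C} {a : X ⟶ V} {f₁ : V ⟶ V₁} {f₂ : V ⟶ V₂}
    {g₁ : V₁ ⟶ W} {g₂ : V₂ ⟶ W} {p₁ : P ⟶ V₁} {p₂ : P ⟶ V₂} (hP : IsPullback p₁ p₂ g₁ g₂)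
    {c : V ⟶ P} (hc₁ : c ≫ p₁ = f₁) (hc₂ : c ≫ p₂ = f₂) {S₁ S₂ S : EqRel X}
    (ha : IsRegularEpi a) (h₁ : IsQuotient (a ≫ f₁) S₁) (h₂ : IsQuotient (a ≫ f₂) S₂)
    (h : IsQuotient (a ≫ f₁ ≫ g₁) S) :
    IsRegularEpi c ↔ S ≤ S₁ ⊔ S₂ := by
  have hw : f₁ ≫ g₁ = f₂ ≫ g₂ := by rw [← hc₁, ← hc₂, Category.assoc, hP.w, Category.assoc]
  constructor
  · intro hc
    refine EqRel.le_iff.2 fun T x y hxy => ?_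
    have hxy' : (x ≫ a ≫ f₁) ≫ g₁ = (y ≫ a ≫ f₂) ≫ g₂ := by
      have := h.rel_iff.1 hxy
      simp only [Category.assoc] at this ⊢
      rw [this, hw]
    have := isRegularEpi_comp a c
    obtain ⟨T', e, z, he, hz⟩ := exists_cover_lift (a ≫ c) (hP.lift _ _ hxy')
    refine EqRel.sup_rel.2 ⟨T', e, z, he, h₁.rel_iff.2 ?_, h₂.rel_iff.2 ?_⟩
    · have := congrArg (· ≫ p₁) hz
      simpa [hc₁] using this.symm
    · have := congrArg (· ≫ p₂) hz
      simpa [hc₂] using this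
  · intro hS
    have := h₁.isRegularEpi
    have := h₂.isRegularEpi
    obtain ⟨T, e, x, he, hx⟩ := exists_cover_lift (a ≫ f₁) p₁
    obtain ⟨T', e', y, he', hy⟩ := exists_cover_lift (a ≫ f₂) (e ≫ p₂)
    have hxy : S.Rel (e' ≫ x) y := by
      refine h.rel_iff.2 ?_
      have hx' := congrArg (fun k => e' ≫ k ≫ g₁) hx
      have hy' := congrArg (· ≫ g₂) hy
      simp only [Category.assoc] at hx' hy' ⊢
      rw [hx', hw, hy', hP.w]
    obtain ⟨T'', e'', z, he'', hxz, hzy⟩ := EqRel.sup_rel.1 (hxy.mono hS)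
    have := isRegularEpi_comp e' e
    have := isRegularEpi_comp e'' (e' ≫ e)
    refine isRegularEpi_of_fac (f := z ≫ a) (h := e'' ≫ e' ≫ e) (hP.hom_ext ?_ ?_)
    · have h1 := h₁.rel_iff.1 hxz
      simp only [Category.assoc] at h1 hx ⊢
      rw [hc₁, ← h1, hx]
    · have h2 := h₂.rel_iff.1 hzy
      simp only [Category.assoc] at h2 hy ⊢
      rw [hc₂, h2, hy]

/-- A comparison morphism to a pullback, if it is a regular epimorphism, is the quotient by the
meet of the two relations involved. -/
theorem isQuotient_comparison {V V₁ V₂ W P : C} {a : X ⟶ V} {f₁ : V ⟶ V₁} {f₂ : V ⟶ V₂}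
    {g₁ : V₁ ⟶ W} {g₂ : V₂ ⟶ W} {p₁ : P ⟶ V₁} {p₂ : P ⟶ V₂} (hP : IsPullback p₁ p₂ g₁ g₂)
    {c : V ⟶ P} (hc₁ : c ≫ p₁ = f₁) (hc₂ : c ≫ p₂ = f₂) {S₁ S₂ S : EqRel X}
    (ha : IsRegularEpi a) (h₁ : IsQuotient (a ≫ f₁) S₁) (h₂ : IsQuotient (a ≫ f₂) S₂)
    (h : IsQuotient (a ≫ f₁ ≫ g₁) S) (hS : S ≤ S₁ ⊔ S₂) :
    IsQuotient (a ≫ c) (S₁ ⊓ S₂) := by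
  have := (isRegularEpi_comparison_iff hP hc₁ hc₂ ha h₁ h₂ h).2 hS
  refine ⟨isRegularEpi_comp a c, fun {T x y} => ?_⟩
  rw [EqRel.inf_rel, h₁.rel_iff, h₂.rel_iff]
  constructor
  · rintro ⟨k₁, k₂⟩
    refine hP.hom_ext ?_ ?_
    · simpa [hc₁] using k₁
    · simpa [hc₂] using k₂
  · intro k
    have k₁ := congrArg (· ≫ p₁) k
    have k₂ := congrArg (· ≫ p₂) k
    simp only [Category.assoc, hc₁, hc₂] at k₁ k₂
    exact ⟨k₁, k₂⟩

end Quotient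

/-! ### Cubes of quotients of an object -/

section Cube

variable {C : Type u} [Category.{v} C]

instance preservesLimitsOfShape_leftFunc {J : Type*} [Category* J] [HasLimitsOfShape J C] :
    PreservesLimitsOfShape J (Arrow.leftFunc : Arrow C ⥤ C) where
  preservesLimit :=
    preservesLimit_of_preserves_limit_cone
      (Comma.coneOfPreservesIsLimit _ (limit.isLimit _) (limit.isLimit _))
      (limit.isLimit _)

instance preservesLimitsOfShape_rightFunc {J : Type*} [Category* J] [HasLimitsOfShape J C] :
    PreservesLimitsOfShape J (Arrow.rightFunc : Arrow C ⥤ C) where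
  preservesLimit :=
    preservesLimit_of_preserves_limit_cone
      (Comma.coneOfPreservesIsLimit _ (limit.isLimit _) (limit.isLimit _))
      (limit.isLimit _)

variable [BarrExact C] [Maltsev C] {X : C}

/-- A square of quotients of `X` is a double extension if and only if the relation of its terminal
vertex is the join of the relations of the two intermediate ones. -/
theorem doubleExtension_iff {f g : Arrow C} {φ : f ⟶ g} (a : X ⟶ f.left) {S₁ S₂ S : EqRel X}
    (ha : IsRegularEpi a) (h₁ : IsQuotient (a ≫ f.hom) S₁) (h₂ : IsQuotient (a ≫ φ.left) S₂)
    (h : IsQuotient (a ≫ φ.left ≫ g.hom) S) :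
    DoubleExtension (MorphismProperty.regularEpi C) φ ↔ S ≤ S₁ ⊔ S₂ := by
  have h' : IsQuotient (a ≫ f.hom ≫ φ.right) S := by
    rwa [← Arrow.w φ]
  have key := isRegularEpi_comparison_iff (IsPullback.of_hasPullback φ.right g.hom)
    (c := pullback.lift f.hom φ.left φ.w.symm) (pullback.lift_fst _ _ _) (pullback.lift_snd _ _ _)
    ha h₁ h₂ h'
  have e₁ := h₁.isRegularEpi
  have e₂ := h₂.isRegularEpi
  have e := h.isRegularEpi
  have e' := h'.isRegularEpi
  rw [← Category.assoc] at e e'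
  exact ⟨fun hφ => key.1 hφ.2.2.2.2, fun hS => ⟨isRegularEpi_of_comp a _,
    isRegularEpi_of_comp (a ≫ φ.left) _, isRegularEpi_of_comp a _,
    isRegularEpi_of_comp (a ≫ f.hom) _, key.2 hS⟩⟩

/-- For a cube of quotients of `X` in which the relation of each vertex is the join of those of
the edges leading to it, all faces are double extensions, and the cube is a `3`-cubic extension
precisely when the square formed by its comparison morphism is a double extension. -/
theorem isThreeCubicExtension_iff {F : Arrow (Arrow (Arrow C))} (a : X ⟶ F.left.left.left)
    {R₀ R₁ R₂ : EqRel X} (ha : IsRegularEpi a)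
    (h₀ : IsQuotient (a ≫ F.left.left.hom) R₀)
    (h₁ : IsQuotient (a ≫ F.left.hom.left) R₁)
    (h₂ : IsQuotient (a ≫ F.hom.left.left) R₂)
    (h₁₀ : IsQuotient (a ≫ F.left.hom.left ≫ F.left.right.hom) (R₁ ⊔ R₀))
    (h₂₀ : IsQuotient (a ≫ F.hom.left.left ≫ F.right.left.hom) (R₂ ⊔ R₀))
    (h₂₁ : IsQuotient (a ≫ F.hom.left.left ≫ F.right.hom.left) (R₂ ⊔ R₁))
    (h₂₁₀ : IsQuotient (a ≫ F.hom.left.left ≫ F.right.hom.left ≫ F.right.right.hom)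
      (R₂ ⊔ R₁ ⊔ R₀)) :
    IsThreeCubicExtension F ↔ R₀ ⊔ R₁ ⊓ R₂ = (R₀ ⊔ R₁) ⊓ (R₀ ⊔ R₂) := by
  obtain ⟨f, g, φ⟩ := F
  change X ⟶ f.left.left at a
  change IsQuotient (a ≫ f.left.hom) R₀ at h₀
  change IsQuotient (a ≫ f.hom.left) R₁ at h₁
  change f ⟶ g at φ
  change IsQuotient (a ≫ φ.left.left) R₂ at h₂
  change IsQuotient (a ≫ f.hom.left ≫ f.right.hom) (R₁ ⊔ R₀) at h₁₀
  change IsQuotient (a ≫ φ.left.left ≫ g.left.hom) (R₂ ⊔ R₀) at h₂₀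
  change IsQuotient (a ≫ φ.left.left ≫ g.hom.left) (R₂ ⊔ R₁) at h₂₁
  change IsQuotient (a ≫ φ.left.left ≫ g.hom.left ≫ g.right.hom) (R₂ ⊔ R₁ ⊔ R₀) at h₂₁₀
  have w : φ.left.left ≫ g.hom.left = f.hom.left ≫ φ.right.left :=
    congrArg CommaMorphism.left (Arrow.w φ)
  have wf : f.hom.left ≫ f.right.hom = f.left.hom ≫ f.hom.right := Arrow.w f.hom
  have wg : g.hom.left ≫ g.right.hom = g.left.hom ≫ g.hom.right := Arrow.w g.hom
  have wφ : φ.left.left ≫ g.left.hom = f.left.hom ≫ φ.left.right := Arrow.w φ.left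
  have wφ' : φ.right.left ≫ g.right.hom = f.right.hom ≫ φ.right.right := Arrow.w φ.right
  let c : f.left ⟶ pullback φ.right g.hom := pullback.lift f.hom φ.left φ.w.symm
  have hc₁ : c ≫ pullback.fst _ _ = f.hom := pullback.lift_fst _ _ _
  have hc₂ : c ≫ pullback.snd _ _ = φ.left := pullback.lift_snd _ _ _
  have key : DoubleExtension (MorphismProperty.regularEpi C) c ↔
      (R₁ ⊔ R₀) ⊓ (R₂ ⊔ R₀) ≤ R₀ ⊔ R₁ ⊓ R₂ := by
    refine doubleExtension_iff a ha h₀ ?_ ?_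
    · refine isQuotient_comparison
        ((IsPullback.of_hasPullback φ.right g.hom).map Arrow.leftFunc)
        (congrArg CommaMorphism.left hc₁) (congrArg CommaMorphism.left hc₂) ha h₁ h₂
        (S := R₂ ⊔ R₁) ?_ (sup_comm _ _).le
      change IsQuotient (a ≫ f.hom.left ≫ φ.right.left) _
      rwa [← w]
    · have hw : c.left ≫ (pullback φ.right g.hom).hom = f.left.hom ≫ c.right := Arrow.w c
      rw [hw, ← Category.assoc]
      refine isQuotient_comparison
        ((IsPullback.of_hasPullback φ.right g.hom).map Arrow.rightFunc)
        (congrArg CommaMorphism.right hc₁) (congrArg CommaMorphism.right hc₂) h₀.isRegularEpi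
        (S := R₂ ⊔ R₁ ⊔ R₀) ?_ ?_ ?_ (by order)
      · change IsQuotient ((a ≫ f.left.hom) ≫ f.hom.right) _
        rwa [Category.assoc, ← wf]
      · change IsQuotient ((a ≫ f.left.hom) ≫ φ.left.right) _
        rwa [Category.assoc, ← wφ]
      · change IsQuotient ((a ≫ f.left.hom) ≫ f.hom.right ≫ φ.right.right) _
        rwa [Category.assoc, ← reassoc_of% wf, ← wφ', ← reassoc_of% w]
  have e₁ := h₁.isRegularEpi
  have e₂ := h₂.isRegularEpi
  have hle : R₀ ⊔ R₁ ⊓ R₂ = (R₀ ⊔ R₁) ⊓ (R₀ ⊔ R₂) ↔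
      (R₁ ⊔ R₀) ⊓ (R₂ ⊔ R₀) ≤ R₀ ⊔ R₁ ⊓ R₂ := by
    rw [sup_comm R₁ R₀, sup_comm R₂ R₀]
    exact ⟨fun h => h.ge, fun h => le_antisymm sup_inf_le h⟩
  rw [hle, ← key]
  refine ⟨fun h => h.2.2.2.2, fun h => ⟨?_, ?_, ?_, ?_, h⟩⟩
  · exact (doubleExtension_iff (φ := f.hom) a ha h₀ h₁ h₁₀).2 (sup_comm _ _).le
  · refine (doubleExtension_iff (φ := g.hom) (a ≫ φ.left.left) e₂ (S₁ := R₂ ⊔ R₀)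
      (S₂ := R₂ ⊔ R₁) (S := R₂ ⊔ R₁ ⊔ R₀) ?_ ?_ ?_).2 (by order)
    · rwa [Category.assoc]
    · rwa [Category.assoc]
    · rwa [Category.assoc]
  · exact (doubleExtension_iff (φ := φ.left) a ha h₀ h₂ h₂₀).2 (sup_comm _ _).le
  · refine (doubleExtension_iff (φ := φ.right) (a ≫ f.hom.left) e₁ (S₁ := R₁ ⊔ R₀)
      (S₂ := R₂ ⊔ R₁) (S := R₂ ⊔ R₁ ⊔ R₀) ?_ ?_ ?_).2 (by order)
    · rwa [Category.assoc]
    · rwa [Category.assoc, ← w]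
    · rwa [Category.assoc, ← reassoc_of% w]

end Cube

/-! ### Coequalisers of reflexive graphs as quotients -/

section Coequaliser

variable {C : Type u} [Category.{v} C]

open WalkingReflexivePair

theorem exists_colimit_desc {L : RGrph C} {t : Cocone L} (ht : IsColimit t) {Z : C}
    {k : L.obj zero ⟶ Z} (hk : L.map .left ≫ k = L.map .right ≫ k) :
    ∃ d : t.pt ⟶ Z, t.ι.app zero ≫ d = k :=
  ⟨ht.desc (ReflexiveCofork.mk k hk), ht.fac (ReflexiveCofork.mk k hk) zero⟩

theorem isRegularEpi_ι_zero {L : RGrph C} {t : Cocone L} (ht : IsColimit t) :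
    IsRegularEpi (t.ι.app zero) := by
  refine ⟨⟨⟨_, L.map .left, L.map .right, ReflexiveCofork.condition t, ?_⟩⟩⟩
  choose d hd using fun s : Cofork (L.map .left) (L.map .right) =>
    exists_colimit_desc ht s.condition
  refine Cofork.IsColimit.mk _ d hd fun s m hm => ht.hom_ext fun j => ?_
  have h0 : t.ι.app zero ≫ m = t.ι.app zero ≫ d s := hm.trans (hd s).symm
  cases j
  · exact h0
  · rw [← t.w WalkingReflexivePair.Hom.left]
    simpa only [Category.assoc] using congrArg (L.map .left ≫ ·) h0

/-- The relation `S` on `X` covers the edges of the reflexive graph `L`: there is an epimorphism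
from `S` to the object of edges of `L` that lies over the morphism `q` from `X` to the object of
vertices. Hence a morphism out of the object of vertices of `L` coequalises `L` if and only if its
composite with `q` identifies the elements related by `S`. -/
def CoversEdges [HasFiniteLimits C] {X : C} (L : RGrph C) (q : X ⟶ L.obj zero) (S : EqRel X) :
    Prop :=
  ∃ p : S.obj ⟶ L.obj one, Epi p ∧ p ≫ L.map .left = S.fst ≫ q ∧ p ≫ L.map .right = S.snd ≫ q

theorem CoversEdges.map [HasFiniteLimits C] {X : C} {L L' : RGrph C} {q : X ⟶ L.obj zero}
    {S : EqRel X} (h : CoversEdges L q S) (φ : L ⟶ L') (hφ : Epi (φ.app one)) :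
    CoversEdges L' (q ≫ φ.app zero) S := by
  obtain ⟨p, hp, h₁, h₂⟩ := h
  refine ⟨p ≫ φ.app one, epi_comp _ _, ?_, ?_⟩
  · rw [Category.assoc, ← φ.naturality, reassoc_of% h₁]
  · rw [Category.assoc, ← φ.naturality, reassoc_of% h₂]

/-- If `q` is the quotient of `X` by `R`, and `L` is a reflexive graph on it whose edges are
covered by `S`, then the coequaliser of `L` is the quotient of `X` by `R ⊔ S`. -/
theorem IsQuotient.comp_colimit [BarrExact C] [Maltsev C] {X : C} {L : RGrph C}
    {q : X ⟶ L.obj zero} {R S : EqRel X} (hq : IsQuotient q R) (hS : CoversEdges L q S)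
    {t : Cocone L} (ht : IsColimit t) : IsQuotient (q ≫ t.ι.app zero) (R ⊔ S) := by
  obtain ⟨p, hp, hp₁, hp₂⟩ := hS
  have := hq.isRegularEpi
  have := isRegularEpi_ι_zero ht
  refine ⟨isRegularEpi_comp _ _, fun {T x y} => ⟨fun h => ?_, fun h => ?_⟩⟩
  · obtain ⟨T', e, z, he, h₁, h₂⟩ := EqRel.sup_rel.1 h
    obtain ⟨k, hk₁, hk₂⟩ := S.rel_iff_exists_lift.1 h₂
    have e₁ := hq.rel_iff.1 h₁
    rw [← cancel_epi e, ← Category.assoc, ← Category.assoc, ← Category.assoc e, ← Category.assoc,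
      e₁, ← hk₁, ← hk₂]
    have hc := ReflexiveCofork.condition t
    simp only [Category.assoc]
    rw [← reassoc_of% hp₁, ← reassoc_of% hp₂]
    exact congrArg (fun m => k ≫ p ≫ m) hc
  · -- The quotient by `R ⊔ S` factors through `q`, and then through the coequaliser of `L`.
    obtain ⟨V, r, hr⟩ := exists_isQuotient (R ⊔ S)
    obtain ⟨g, hg⟩ := hq.exists_fac fun h => hr.rel_iff.1 (h.mono le_sup_left)
    have hg' : L.map .left ≫ g = L.map .right ≫ g := by
      rw [← cancel_epi p, reassoc_of% hp₁, reassoc_of% hp₂, hg]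
      exact hr.rel_iff.1 (S.rel_fst_snd.mono le_sup_right)
    obtain ⟨d, hd⟩ := exists_colimit_desc ht hg'
    refine hr.rel_iff.2 ?_
    rw [← hg, ← hd]
    simpa only [Category.assoc] using
congrArg (· ≫ d) h

end Coequaliser

/-! ### Vertices and edges of the parallelistic threefold equivalence relation -/

section Box

variable {C : Type u} [Category.{v} C] [Regular C] {X : C} (R : Fin 3 → EqRel X)

open WalkingReflexivePair

/-- The entry at `e` of the matrices of shape `a`. -/
noncomputable def boxEntry
    {a : WalkingReflexivePair × WalkingReflexivePair × WalkingReflexivePair} (e : Entry a) :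
    (boxFunctor R).obj a ⟶ X :=
  (boxSub R a).arrow ≫ Pi.π _ e

variable {R}

theorem boxFunctor_hom_ext
    {a : WalkingReflexivePair × WalkingReflexivePair × WalkingReflexivePair} {T : C}
    {f g : T ⟶ (boxFunctor R).obj a} (h : ∀ e, f ≫ boxEntry R e = g ≫ boxEntry R e) : f = g := by
  refine (cancel_mono (boxSub R a).arrow).1 (Pi.hom_ext _ _ fun e => ?_)
  exact (Category.assoc f _ _).trans ((h e).trans (Category.assoc g _ _).symm)

theorem boxFunctor_map_entry
    {a b : WalkingReflexivePair × WalkingReflexivePair × WalkingReflexivePair} (f : a ⟶ b)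
    (e : Entry b) : (boxFunctor R).map f ≫ boxEntry R e = boxEntry R (Entry.map f e) := by
  refine (Subobject.factorThru_arrow_assoc (boxSub R b) _ (reindex_factors R f) _).trans ?_
  rw [reindex, Category.assoc, Pi.lift_π]
  rfl

theorem boxEntry_rel {a : WalkingReflexivePair × WalkingReflexivePair × WalkingReflexivePair}
    {i : Fin 3} {p q : Entry a} (h : Aligned i p q) :
    (R i).Rel (boxEntry R p) (boxEntry R q) :=
  (boxSub_factors R _).1 (Subobject.factors_self (boxSub R a)) i p q h

theorem exists_boxEntry_eq
    {a : WalkingReflexivePair × WalkingReflexivePair × WalkingReflexivePair} {T : C}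
    (x : Entry a → (T ⟶ X)) (h : ∀ i p q, Aligned i p q → (R i).Rel (x p) (x q)) :
    ∃ m : T ⟶ (boxFunctor R).obj a, ∀ e, m ≫ boxEntry R e = x e := by
  have hm : (boxSub R a).Factors (Pi.lift x) := by
    rw [boxSub_factors]
    simpa only [Pi.lift_π] using h
  refine ⟨(boxSub R a).factorThru _ hm, fun e => ?_⟩
  exact (Subobject.factorThru_arrow_assoc _ _ _ _).trans (Pi.lift_π _ _)

variable (R)

/-- The `1 × 1 × 1`-matrices are the elements of `X`. -/
theorem exists_iso_vertex : ∃ m : X ⟶ (boxFunctor R).obj (zero, zero, zero),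
    IsIso m ∧ ∀ e, m ≫ boxEntry R e = 𝟙 X := by
  obtain ⟨m, hm⟩ := exists_boxEntry_eq (R := R) (a := (zero, zero, zero)) (fun _ => 𝟙 X)
    fun i _ _ _ => EqRel.rel_refl _ _
  refine ⟨m, ⟨boxEntry R ((), (), ()), hm _, boxFunctor_hom_ext fun e => ?_⟩, hm⟩
  rw [Category.assoc, hm, Category.comp_id, Category.id_comp]
  rfl

/-- The edges of `box R` in direction `j` are the elements of `R j`. The shape `a` is the one of
the `2 × 1 × 1`-matrices pointing in the direction `j`; its two entries are `t false` and
`t true`. -/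
theorem exists_epi_edges (j : Fin 3)
    {a : WalkingReflexivePair × WalkingReflexivePair × WalkingReflexivePair} (s : Entry a → Bool)
    (t : Bool → Entry a) (hts : ∀ e, t (s e) = e)
    (ht : Aligned j (t false) (t true)) (ha : ∀ i p q, Aligned i p q → i ≠ j → s p = s q)
    (f g : a ⟶ (zero, zero, zero)) (hf : ∀ e, s (Entry.map f e) = false)
    (hg : ∀ e, s (Entry.map g e) = true) {v : X ⟶ (boxFunctor R).obj (zero, zero, zero)}
    (hv : ∀ e, v ≫ boxEntry R e = 𝟙 X) :
    ∃ p : (R j).obj ⟶ (boxFunctor R).obj a, Epi p ∧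
      p ≫ (boxFunctor R).map f = (R j).fst ≫ v ∧ p ≫ (boxFunctor R).map g = (R j).snd ≫ v := by
  obtain ⟨p, hp⟩ := exists_boxEntry_eq (R := R) (a := a)
    (fun e => if s e then (R j).snd else (R j).fst) fun i e e' h => by
      by_cases hij : i = j
      · subst hij
        cases s e <;> cases s e'
        · exact EqRel.rel_refl _ _
        · exact (R i).rel_fst_snd
        · exact (R i).rel_fst_snd.symm
        · exact EqRel.rel_refl _ _
      · rw [ha i e e' h hij]
        exact EqRel.rel_refl _ _
  refine ⟨p, ?_, boxFunctor_hom_ext fun e => ?_, boxFunctor_hom_ext fun e => ?_⟩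
  · obtain ⟨k, hk₁, hk₂⟩ := (R j).rel_iff_exists_lift.1 (boxEntry_rel ht)
    have : k ≫ p = 𝟙 _ := boxFunctor_hom_ext fun e => by
      rw [Category.assoc, hp, Category.id_comp]
      have := hts e
      cases h : s e <;> rw [h] at this <;> subst this
      · exact hk₁
      · exact hk₂
    exact epi_of_epi_fac this
  · rw [Category.assoc, boxFunctor_map_entry, hp, hf, Category.assoc, hv, Category.comp_id]
    rfl
  · rw [Category.assoc, boxFunctor_map_entry, hp, hg, Category.assoc, hv, Category.comp_id]
    rfl

end Box

/-! ### The induced threefold regular epimorphism -/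

section InducedCube

variable {C : Type u} [Category.{v} C] [BarrExact C] [Maltsev C] {X : C} (R : Fin 3 → EqRel X)

open WalkingReflexivePair

theorem coversEdges_outer {v : X ⟶ (boxFunctor R).obj (zero, zero, zero)}
    (hv : ∀ e, v ≫ boxEntry R e = 𝟙 X) :
    CoversEdges (box R ⋙ (evaluation _ _).obj zero ⋙ (evaluation _ _).obj zero) v (R 2) :=
  exists_epi_edges R 2 (a := (one, zero, zero)) (fun e => e.1) (fun b => (b, (), ()))
    (fun _ => rfl) ⟨fun h => (h rfl).elim, fun _ => rfl, fun _ => rfl⟩ (fun _ _ _ h hi => h.1 hi)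
    (Hom.left, 𝟙 zero, 𝟙 zero) (Hom.right, 𝟙 zero, 𝟙 zero) (fun _ => rfl) (fun _ => rfl) hv

theorem coversEdges_middle {v : X ⟶ (boxFunctor R).obj (zero, zero, zero)}
    (hv : ∀ e, v ≫ boxEntry R e = 𝟙 X) :
    CoversEdges ((box R).obj zero ⋙ (evaluation _ _).obj zero) v (R 1) :=
  exists_epi_edges R 1 (a := (zero, one, zero)) (fun e => e.2.1) (fun b => ((), b, ()))
    (fun _ => rfl) ⟨fun _ => rfl, fun h => (h rfl).elim, fun _ => rfl⟩ (fun _ _ _ h hi => h.2.1 hi)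
    (𝟙 zero, Hom.left, 𝟙 zero) (𝟙 zero, Hom.right, 𝟙 zero) (fun _ => rfl) (fun _ => rfl) hv

theorem coversEdges_inner {v : X ⟶ (boxFunctor R).obj (zero, zero, zero)}
    (hv : ∀ e, v ≫ boxEntry R e = 𝟙 X) :
    CoversEdges (((box R).obj zero).obj zero) v (R 0) :=
  exists_epi_edges R 0 (a := (zero, zero, one)) (fun e => e.2.2) (fun b => ((), (), b))
    (fun _ => rfl) ⟨fun _ => rfl, fun _ => rfl, fun h => (h rfl).elim⟩ (fun _ _ _ h hi => h.2.2 hi)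
    (𝟙 zero, 𝟙 zero, Hom.left) (𝟙 zero, 𝟙 zero, Hom.right) (fun _ => rfl) (fun _ => rfl) hv

variable {R}

/-- Let `G` be a threefold reflexive graph with object of vertices `X` whose edges in the three
directions are covered by `R₂`, `R₁` and `R₀`. The coequaliser in one direction maps the edges in
the remaining directions onto the edges of the quotient, so that these are still covered, and each
vertex of the cube `Coeq₃ G` is the quotient of `X` by the join of the relations in the directions
in which it has been coequalised. -/
theorem isThreeCubicExtension_coeq_iff {G : RGrph (RGrph (RGrph C))}
    {v : X ⟶ ((G.obj zero).obj zero).obj zero} {R₀ R₁ R₂ : EqRel X} (q : IsQuotient v ⊥)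
    (h₂ : CoversEdges (G ⋙ (evaluation _ _).obj zero ⋙ (evaluation _ _).obj zero) v R₂)
    (h₁ : CoversEdges (G.obj zero ⋙ (evaluation _ _).obj zero) v R₁)
    (h₀ : CoversEdges ((G.obj zero).obj zero) v R₀) :
    IsThreeCubicExtension ((Coeq₃ C).obj G) ↔ R₀ ⊔ R₁ ⊓ R₂ = (R₀ ⊔ R₁) ⊓ (R₀ ⊔ R₂) := by
  let ev : RGrph C ⥤ C := (evaluation _ _).obj zero
  have t₂ (a b : WalkingReflexivePair) :
      IsColimit (((evaluation _ _).obj a ⋙ (evaluation _ _).obj b).mapCocone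
        (colimit.cocone G)) :=
    isColimitOfPreserves _ (colimit.isColimit G)
  have t₁ (K : RGrph (RGrph C)) (a : WalkingReflexivePair) :
      IsColimit (((evaluation _ _).obj a).mapCocone (colimit.cocone K)) :=
    isColimitOfPreserves _ (colimit.isColimit K)
  -- The coequalisers are computed objectwise, so that all their components are epimorphisms.
  have epi₁ (K : RGrph (RGrph C)) (a : WalkingReflexivePair) :
      Epi ((colimit.ι K zero).app a) := by
    have := isRegularEpi_ι_zero (t₁ K a)
    exact (inferInstance : Epi ((((evaluation _ _).obj a).mapCocone (colimit.cocone K)).ι.app zero))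
  have epi₂ (a b : WalkingReflexivePair) : Epi (((colimit.ι G zero).app a).app b) := by
    have := isRegularEpi_ι_zero (t₂ a b)
    exact (inferInstance : Epi ((((evaluation _ _).obj a ⋙ (evaluation _ _).obj b).mapCocone
      (colimit.cocone G)).ι.app zero))
  have h₂₁ := h₁.map (Functor.whiskerRight (colimit.ι G zero) ev) (epi₂ _ _)
  have h₂₀ := h₀.map ((colimit.ι G zero).app zero) (epi₂ _ _)
  have h₁₀ := h₀.map (colimit.ι (G.obj zero) zero) (epi₁ _ _)
  have h₂₁₀ : CoversEdges (colimit (colimit G)) ((v ≫ ((colimit.ι G zero).app zero).app zero) ≫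
      (colimit.ι (colimit G) zero).app zero) R₀ :=
    h₂₀.map (colimit.ι (colimit G) zero) (epi₁ _ _)
  have q₂ : IsQuotient (v ≫ ((colimit.ι G zero).app zero).app zero) (⊥ ⊔ R₂) :=
    q.comp_colimit (L := G ⋙ (evaluation _ _).obj zero ⋙ ev) h₂ (t₂ _ _)
  have q₁ : IsQuotient (v ≫ (colimit.ι (G.obj zero) zero).app zero) (⊥ ⊔ R₁) :=
    q.comp_colimit (L := G.obj zero ⋙ ev) h₁ (t₁ _ _)
  have q₀ := q.comp_colimit h₀ (colimit.isColimit _)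
  have q₂₁ : IsQuotient ((v ≫ ((colimit.ι G zero).app zero).app zero) ≫
      (colimit.ι (colimit G) zero).app zero) (⊥ ⊔ R₂ ⊔ R₁) :=
    q₂.comp_colimit (L := colimit G ⋙ ev) h₂₁ (t₁ _ _)
  have q₂₀ := q₂.comp_colimit h₂₀ (colimit.isColimit _)
  have q₁₀ := q₁.comp_colimit h₁₀ (colimit.isColimit _)
  have q₂₁₀ := q₂₁.comp_colimit h₂₁₀ (colimit.isColimit _)
  rw [bot_sup_eq] at q₂ q₁ q₀ q₂₁ q₂₀ q₁₀ q₂₁₀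
  rw [Category.assoc] at q₂₁ q₂₀ q₁₀ q₂₁₀
  rw [Category.assoc] at q₂₁₀
  exact isThreeCubicExtension_iff v q.isRegularEpi q₀ q₁ q₂ q₁₀ q₂₀ q₂₁ q₂₁₀

variable (R)

/-- The threefold regular epimorphism induced by `R` is a `3`-cubic extension if and only if `R`
satisfies one of the distributive laws. -/
theorem isThreeCubicExtension_inducedCube_iff :
    IsThreeCubicExtension (inducedCube R) ↔ R 0 ⊔ R 1 ⊓ R 2 = (R 0 ⊔ R 1) ⊓ (R 0 ⊔ R 2) := by
  obtain ⟨v, hv, hv'⟩ := exists_iso_vertex R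
  exact isThreeCubicExtension_coeq_iff
    (isQuotient_bot v)
    (coversEdges_outer R hv') (coversEdges_middle R hv') (coversEdges_inner R hv')

end InducedCube

/-! ### Invariance of cubic extensions under isomorphism -/

section RespectsIso

theorem comp_pullback_lift_eq_lift_comp_map {D : Type*} [Category* D] [HasPullbacks D]
    {A B K W A' B' K' W' : D} {f₁ : A ⟶ B} {f₂ : A ⟶ K} {g₁ : B ⟶ W} {g₂ : K ⟶ W}
    {f₁' : A' ⟶ B'} {f₂' : A' ⟶ K'} {g₁' : B' ⟶ W'} {g₂' : K' ⟶ W'} (h : f₁ ≫ g₁ = f₂ ≫ g₂)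
    (h' : f₁' ≫ g₁' = f₂' ≫ g₂') {a : A ⟶ A'} {b : B ⟶ B'} {k : K ⟶ K'} {w : W ⟶ W'}
    (h₁ : a ≫ f₁' = f₁ ≫ b) (h₂ : a ≫ f₂' = f₂ ≫ k) (e₁ : g₁ ≫ w = b ≫ g₁')
    (e₂ : g₂ ≫ w = k ≫ g₂') :
    a ≫ pullback.lift f₁' f₂' h' =
      pullback.lift f₁ f₂ h ≫ pullback.map g₁ g₂ g₁' g₂' b k w e₁ e₂ := by
  have m₁ : pullback.map g₁ g₂ g₁' g₂' b k w e₁ e₂ ≫ pullback.fst g₁' g₂' =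
      pullback.fst g₁ g₂ ≫ b := pullback.lift_fst _ _ _
  have m₂ : pullback.map g₁ g₂ g₁' g₂' b k w e₁ e₂ ≫ pullback.snd g₁' g₂' =
      pullback.snd g₁ g₂ ≫ k := pullback.lift_snd _ _ _
  have l₁ : pullback.lift f₁ f₂ h ≫ pullback.fst g₁ g₂ = f₁ := pullback.lift_fst _ _ _
  have l₂ : pullback.lift f₁ f₂ h ≫ pullback.snd g₁ g₂ = f₂ := pullback.lift_snd _ _ _
  have l₁' : pullback.lift f₁' f₂' h' ≫ pullback.fst g₁' g₂' = f₁' := pullback.lift_fst _ _ _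
  have l₂' : pullback.lift f₁' f₂' h' ≫ pullback.snd g₁' g₂' = f₂' := pullback.lift_snd _ _ _
  refine pullback.hom_ext ?_ ?_
  · rw [Category.assoc, Category.assoc, m₁, l₁', reassoc_of% l₁, h₁]
  · rw [Category.assoc, Category.assoc, m₂, l₂', reassoc_of% l₂, h₂]

theorem doubleExtension_respectsIso {D : Type*} [Category* D] [HasPullbacks D]
    (E : MorphismProperty D) [E.RespectsIso] : (DoubleExtension E).RespectsIso := by
  refine MorphismProperty.RespectsIso.of_respects_arrow_iso _ fun φ ψ e h => ?_
  obtain ⟨f, g, φ⟩ := φ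
  obtain ⟨f', g', ψ⟩ := ψ
  change f ⟶ g at φ
  change f' ⟶ g' at ψ
  let i : f ≅ f' := Arrow.leftFunc.mapIso e
  let j : g ≅ g' := Arrow.rightFunc.mapIso e
  have w : i.hom ≫ ψ = φ ≫ j.hom := Arrow.w e.hom
  obtain ⟨h₁, h₂, h₃, h₄, h₅⟩ := h
  have wl : i.hom.left ≫ ψ.left = φ.left ≫ j.hom.left := congrArg CommaMorphism.left w
  have wr : i.hom.right ≫ ψ.right = φ.right ≫ j.hom.right := congrArg CommaMorphism.right w
  have wi : i.hom.left ≫ f'.hom = f.hom ≫ i.hom.right := Arrow.w i.hom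
  have wj : j.hom.left ≫ g'.hom = g.hom ≫ j.hom.right := Arrow.w j.hom
  exact ⟨(E.arrow_iso_iff i).1 h₁, (E.arrow_iso_iff j).1 h₂,
    (E.arrow_mk_iso_iff (Arrow.isoMk (Arrow.leftFunc.mapIso i) (Arrow.leftFunc.mapIso j) wl)).1 h₃,
    (E.arrow_mk_iso_iff
      (Arrow.isoMk (Arrow.rightFunc.mapIso i) (Arrow.rightFunc.mapIso j) wr)).1 h₄,
    (E.arrow_mk_iso_iff (Arrow.isoMk (Arrow.leftFunc.mapIso i) (asIso (pullback.map _ _ _ _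
      i.hom.right j.hom.left j.hom.right wr.symm wj.symm))
      (comp_pullback_lift_eq_lift_comp_map _ _ wi wl wr.symm wj.symm))).1 h₅⟩

theorem isThreeCubicExtension_of_iso {C : Type u} [Category.{v} C] [HasFiniteLimits C]
    {F F' : Arrow (Arrow (Arrow C))} (e : F ≅ F') (h : IsThreeCubicExtension F) :
    IsThreeCubicExtension F' := by
  have := doubleExtension_respectsIso (MorphismProperty.regularEpi C)
  have := doubleExtension_respectsIso (DoubleExtension (MorphismProperty.regularEpi C))
  exact (MorphismProperty.arrow_iso_iff _ e).1 h

end RespectsIso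

end ExactMaltsev

open ExactMaltsev

theorem mainTheorem8 {C : Type u} [Category.{v} C] [ExactMaltsev.BarrExact C]
    [ExactMaltsev.Maltsev C] {X : C} (R : Fin 3 → ExactMaltsev.EqRel X) :
    List.TFAE [
      ExactMaltsev.IsThreeCubicExtension (ExactMaltsev.inducedCube R),
      R 2 ⊔ (R 0 ⊓ R 1) = (R 2 ⊔ R 0) ⊓ (R 2 ⊔ R 1),
      R 1 ⊔ (R 0 ⊓ R 2) = (R 1 ⊔ R 0) ⊓ (R 1 ⊔ R 2),
      R 0 ⊔ (R 1 ⊓ R 2) = (R 0 ⊔ R 1) ⊓ (R 0 ⊔ R 2),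
      R 2 ⊓ (R 0 ⊔ R 1) = (R 2 ⊓ R 0) ⊔ (R 2 ⊓ R 1),
      R 1 ⊓ (R 0 ⊔ R 2) = (R 1 ⊓ R 0) ⊔ (R 1 ⊓ R 2),
      R 0 ⊓ (R 1 ⊔ R 2) = (R 0 ⊓ R 1) ⊔ (R 0 ⊓ R 2),
      ExactMaltsev.Distributive R,
      ExactMaltsev.IsDistributiveParallelistic (ExactMaltsev.box R),
      ExactMaltsev.square (R 2) (R 0 ⊔ R 1) =
        ExactMaltsev.square (R 2) (R 0) ⊔ ExactMaltsev.square (R 2) (R 1),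
      ExactMaltsev.square (R 1) (R 0 ⊔ R 2) =
        ExactMaltsev.square (R 1) (R 0) ⊔ ExactMaltsev.square (R 1) (R 2),
      ExactMaltsev.square (R 0) (R 1 ⊔ R 2) =
        ExactMaltsev.square (R 0) (R 1) ⊔ ExactMaltsev.square (R 0) (R 2)] := by
  tfae_have 1 ↔ 4 := isThreeCubicExtension_inducedCube_iff R
  tfae_have 7 → 3 := fun h => sup_inf_eq_of_inf_sup_eq h
  tfae_have 3 → 5 := fun h => by
    rw [inf_comm, inf_comm (R 1 ⊔ R 0)] at h
    simpa only [sup_comm] using inf_sup_eq_of_sup_inf_eq h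
  tfae_have 5 → 4 := fun h => by
    rw [inf_comm (R 1), inf_comm (R 0 ⊔ R 1)]
    exact sup_inf_eq_of_inf_sup_eq h
  tfae_have 4 → 6 := fun h => inf_sup_eq_of_sup_inf_eq h
  tfae_have 6 → 2 := fun h => by
    rw [sup_comm (R 0), sup_comm (R 1 ⊓ R 0)] at h
    rw [inf_comm (R 0), inf_comm (R 2 ⊔ R 0)]
    exact sup_inf_eq_of_inf_sup_eq h
  tfae_have 2 → 7 := fun h => by
    rw [sup_comm (R 1), sup_comm (R 0 ⊓ R 1)]
    exact inf_sup_eq_of_sup_inf_eq h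
  tfae_have 7 → 8 := fun h => by
    have h₂ := inf_sup_eq_rotate h
    have h₁ := inf_sup_eq_rotate h₂
    refine distributive_iff_forall.2 fun i j k hij hik hjk => ?_
    have hswap : ∀ {a b c : EqRel X}, a ⊓ (b ⊔ c) = a ⊓ b ⊔ a ⊓ c →
        a ⊓ (c ⊔ b) = a ⊓ c ⊔ a ⊓ b := fun {a b c} h => by
      rw [sup_comm c, h, sup_comm]
    fin_cases i <;> fin_cases j <;> fin_cases k <;>
      first
        | exact absurd rfl hij
        | exact absurd rfl hik
        | exact absurd rfl hjk
        | exact h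
        | exact h₁
        | exact h₂
        | exact hswap h
        | exact hswap h₁
        | exact hswap h₂
  tfae_have 8 → 9 := fun h => ⟨X, R, ⟨Iso.refl _⟩, h⟩
  -- Isomorphic threefold reflexive graphs have isomorphic coequalisers, so the characterisation
  -- of `3`-cubic extensions can be applied to the distributive triple.
  tfae_have 9 → 1 := by
    rintro ⟨Y, S, ⟨e⟩, hS⟩
    refine isThreeCubicExtension_of_iso ((Coeq₃ C).mapIso e.symm)
      ((isThreeCubicExtension_inducedCube_iff S).2 (sup_inf_eq_of_inf_sup_eq ?_))
    exact distributive_iff_forall.1 hS 1 0 2 (by decide) (by decide) (by decide)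
  tfae_have 2 → 10 := square_sup
  tfae_have 10 → 5 := inf_sup_of_square_sup
  tfae_have 3 → 11 := square_sup
  tfae_have 11 → 6 := inf_sup_of_square_sup
  tfae_have 4 → 12 := square_sup
  tfae_have 12 → 7 := inf_sup_of_square_sup
  tfae_finish
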